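/- **Notation.** Resource types are generated by $a ::= o \mid \langle a_1,\dots,a_k\rangle \multimap a$ ($k\ge 0$); a finite list $\vec a=\langle a_1,\dots,a_k\rangle$ of resource types is an intersection type. For $\spadesuit\in\{l,c\}$ (linear, cartesian), morphisms are generated by $\mathrm{id}_o:o\to o$; by $\langle\alpha;f_1,\dots,f_m\rangle:\langle a_1,\dots,a_n\rangle\to\langle b_1,\dots,b_m\rangle$ for $\alpha:[m]\to[n]$ (required to be bijective if $\spadesuit=l$, arbitrary if $\spadesuit=c$) and $f_i:a_{\alpha(i)}\to b_i$; and by $(f\multimap g):(\vec a\multimap a)\to(\vec b\multimap b)$ for $f:\vec b\to\vec a$ and $g:a\to b$. Structural resource terms are $s::=x\mid\lambda x^{f}.s\mid s\langle t_1,\dots,t_k\rangle$, up to renaming of bound variables, with $f$ a morphism of intersection types of the mode $\spadesuit$. Contexts assign an intersection type to each of the variables $x_1,\dots,x_n$, and $\otimes$ is pointwise concatenation of contexts. Typing: * $x_1:\langle\rangle,\dots,x_i:\langle a\rangle,\dots,x_n:\langle\rangle\vdash x_i:a$; * if $\gamma,x:\vec b\vdash s:a$ and $f:\vec a\to\vec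 b$, then $\gamma\vdash\lambda x^f.s:\vec a\multimap a$; * if $\gamma_0\vdash s:\langle a_1,\dots,a_k\rangle\multimap b$ and $\gamma_i\vdash t_i:a_i$ for $1\le i\le k$, then $\gamma_0\otimes\gamma_1\otimes\cdots\otimes\gamma_k\vdash s\langle t_1,\dots,t_k\rangle:b$. Write $\delta\vdash_\spadesuit s:a$ if $s$ is a term of mode $\spadesuit$ and there are a context $\gamma$ with $\gamma\vdash s:a$ and morphisms $\delta(x_i)\to\gamma(x_i)$ of mode $\spadesuit$ for all $i$ (subtyping of contexts). The approximation relation $s\lhd M$ between resource terms and pure $\lambda$-terms is generated by: $x\lhd x$; $\lambda x^f.s\lhd\lambda x.M$ if $s\lhd M$; $s\langle t_1,\dots,t_k\rangle\lhd MN$ if $s\lhd M$ and $t_i\lhd N$ for all $i$. Multitypes are $A::=o\mid[A_1,\dots,A_k]\multimap A$ with $[A_1,\dots,A_k]$ a finite multiset; $\underline a$ and $\underline\gamma$ are obtained from $a$ and $\gamma$ by replacing all lists by multisets. The Scott preorder $\le$ on multitypes and on finite multisets of multitypes is the least pair of preorders with $[A]\le[A,A]$, $[A_1,A_2]\le[A_i]$,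 $[A_1,\dots,A_k]\le[\,]$, and such that $A\le B$ implies $[A]\le[B]$; $m\le m'$ and $p\le p'$ imply $m+p\le m'+p'$ (with $+$ the multiset union); and $m'\le m$ and $A\le A'$ imply $(m\multimap A)\le(m'\multimap A')$. It is extended pointwise to contexts. For a pure $\lambda$-term $M$ with free variables among $x_1,\dots,x_n$, the Scott (idempotent) and the relational (non-idempotent) interpretations are $$[\![M]\!]_{\mathsf{scott}}=\{(\underline\gamma,\underline a)\mid \gamma\vdash_c s:a\text{ for some } s\lhd M\},\qquad [\![M]\!]_{\mathsf{rel}}=\{(\underline\gamma,\underline a)\mid \gamma\vdash_l s:a\text{ for some } s\lhd M\}.$$ **Theorem (extensional collapse).** For every pure $\lambda$-term $M$ with free variables among $x_1,\dots,x_n$, one has $[\![M]\!]_{\mathsf{scott}}={\downarrow}[\![M]\!]_{\mathsf{rel}}$, where $${\downarrow}[\![M]\!]_{\mathsf{rel}}=\{(\Gamma,A)\mid\text{there is }(\Gamma',B)\in[\![M]\!]_{\mathsf{rel}}\text{ with }\Gamma\le\Gamma'\text{ and }B\le A\}.$$ -/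

import Mathlib

namespace Resource

/-! ### Resource types and their morphisms -/

/-- Resource types `a ::= o | ⟨a₁, …, aₖ⟩ ⊸ a`. An intersection type is a list of resource types. -/
inductive RT : Type
  | o : RT
  | arr : List RT → RT → RT

/-- The parameter of the calculus: linear or cartesian. -/
inductive Mode : Type
  | lin : Mode
  | cart : Mode

/-- The maps `[m] → [n]` allowed in each mode: bijections in the linear one, all maps in the
cartesian one. -/
def Mode.Allows (k : Mode) {m n : ℕ} (α : Fin m → Fin n) : Prop :=
  match k with
  | .lin => Function.Bijective α
  | .cart => True

mutual

/-- Morphisms `a → b` of resource types. -/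
inductive Hom (k : Mode) : RT → RT → Type
  | idO : Hom k RT.o RT.o
  | arr {as bs : List RT} {a b : RT} (f : IHom k bs as) (g : Hom k a b) :
      Hom k (RT.arr as a) (RT.arr bs b)

/-- Morphisms `⟨α; f₁, …, fₘ⟩ : ⟨a₁, …, aₙ⟩ → ⟨b₁, …, bₘ⟩` of intersection types, where
`α : [m] → [n]` is allowed and `fᵢ : a_{α(i)} → bᵢ`. -/
inductive IHom (k : Mode) : List RT → List RT → Type
  | mk {as bs : List RT} (α : Fin bs.length → Fin as.length) (hα : k.Allows α)
      (f : ∀ i : Fin bs.length, Hom k (as.get (α i)) (bs.get i)) : IHom k as bs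

end

/-! ### Structural resource terms

Terms are taken up to renaming of bound variables, through well-scoped de Bruijn indices: the
variables of a term in scope `n` are the elements of `Fin n`, and under a binder the bound variable
is `0`. -/

mutual

/-- Structural resource terms `s ::= x | λ x^f. s | s ⟨t₁, …, tₖ⟩` with free variables among `n`
given ones. -/
inductive RTerm (k : Mode) : ℕ → Type
  | var {n : ℕ} (i : Fin n) : RTerm k n
  | lam {n : ℕ} {as bs : List RT} (f : IHom k as bs) (s : RTerm k (n + 1)) : RTerm k n
  | app {n : ℕ} (s : RTerm k n) (t : Bag k n) : RTerm k n

/-- Bags, that is, finite lists of structural resource terms. -/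
inductive Bag (k : Mode) : ℕ → Type
  | nil {n : ℕ} : Bag k n
  | cons {n : ℕ} (s : RTerm k n) (t : Bag k n) : Bag k n

end

/-- Typing contexts: an intersection type for each of the `n` variables. -/
abbrev Ctx (n : ℕ) : Type := Fin n → List RT

/-- The context `x₁ : ⟨⟩, …, xₙ : ⟨⟩`. -/
def Ctx.empty (n : ℕ) : Ctx n := fun _ => []

/-- The context `x₁ : ⟨⟩, …, xᵢ : ⟨a⟩, …, xₙ : ⟨⟩`. -/
def Ctx.single {n : ℕ} (i : Fin n) (a : RT) : Ctx n := Function.update (Ctx.empty n) i [a]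

/-- The tensor product of contexts: pointwise concatenation. -/
def Ctx.tensor {n : ℕ} (γ δ : Ctx n) : Ctx n := fun i => γ i ++ δ i

/-- The context `γ, x : bs`, where `x` becomes the variable `0`. -/
def Ctx.extend {n : ℕ} (γ : Ctx n) (bs : List RT) : Ctx (n + 1) :=
  Fin.cons (α := fun _ => List RT) bs γ

mutual

/-- The typing judgment `γ ⊢ s : a`. -/
inductive Typed {k : Mode} : {n : ℕ} → Ctx n → RTerm k n → RT → Prop
  | var {n : ℕ} (i : Fin n) (a : RT) : Typed (Ctx.single i a) (RTerm.var i) a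
  | lam {n : ℕ} {γ : Ctx n} {as bs : List RT} {a : RT} {s : RTerm k (n + 1)} (f : IHom k as bs)
      (hs : Typed (γ.extend bs) s a) : Typed γ (RTerm.lam f s) (RT.arr as a)
  | app {n : ℕ} {γ₀ γ₁ : Ctx n} {as : List RT} {b : RT} {s : RTerm k n} {t : Bag k n}
      (hs : Typed γ₀ s (RT.arr as b)) (ht : BagTyped γ₁ t as) :
      Typed (γ₀.tensor γ₁) (RTerm.app s t) b

/-- The typing judgment `γ₁ ⊗ ⋯ ⊗ γₖ ⊢ ⟨t₁, …, tₖ⟩ : ⟨a₁, …, aₖ⟩` for bags. -/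
inductive BagTyped {k : Mode} : {n : ℕ} → Ctx n → Bag k n → List RT → Prop
  | nil {n : ℕ} : BagTyped (Ctx.empty n) Bag.nil []
  | cons {n : ℕ} {γ δ : Ctx n} {s : RTerm k n} {t : Bag k n} {a : RT} {as : List RT}
      (hs : Typed γ s a) (ht : BagTyped δ t as) :
      BagTyped (γ.tensor δ) (Bag.cons s t) (a :: as)

end

/-- Typing with the subtyping rule on contexts: `δ ⊢ s : a` holds when `γ ⊢ s : a` for some `γ`
with a morphism `δ(x) → γ(x)` for each variable `x`. -/
def SubTyped {k : Mode} {n : ℕ} (δ : Ctx n) (s : RTerm k n) (a : RT) : Prop :=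
  ∃ γ : Ctx n, (∀ i, Nonempty (IHom k (δ i) (γ i))) ∧ Typed γ s a

/-! ### Ordinary λ-terms and their approximations -/

/-- Pure λ-terms, up to renaming of bound variables, with free variables among `n` given ones. -/
inductive Lam : ℕ → Type
  | var {n : ℕ} (i : Fin n) : Lam n
  | lam {n : ℕ} (M : Lam (n + 1)) : Lam n
  | app {n : ℕ} (M N : Lam n) : Lam n

mutual

/-- The approximation relation `s ◁ M`. -/
inductive Approx {k : Mode} : {n : ℕ} → RTerm k n → Lam n → Prop
  | var {n : ℕ} (i : Fin n) : Approx (RTerm.var i) (Lam.var i)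
  | lam {n : ℕ} {as bs : List RT} (f : IHom k as bs) {s : RTerm k (n + 1)} {M : Lam (n + 1)}
      (hs : Approx s M) : Approx (RTerm.lam f s) (Lam.lam M)
  | app {n : ℕ} {s : RTerm k n} {t : Bag k n} {M N : Lam n}
      (hs : Approx s M) (ht : BagApprox t N) : Approx (RTerm.app s t) (Lam.app M N)

/-- A bag approximates `M` when all its elements do. -/
inductive BagApprox {k : Mode} : {n : ℕ} → Bag k n → Lam n → Prop
  | nil {n : ℕ} {M : Lam n} : BagApprox Bag.nil M
  | cons {n : ℕ} {s : RTerm k n} {t : Bag k n} {M : Lam n}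
      (hs : Approx s M) (ht : BagApprox t M) : BagApprox (Bag.cons s t) M

end

/-! ### Multitypes

Multitypes `A ::= o | [A₁, …, Aₖ] ⊸ A`, with finite multisets in place of lists, are built as
resource types up to permutation of the lists occurring at any depth. -/

mutual

/-- Equality of resource types up to permutation of lists at every depth. -/
inductive PermEq : RT → RT → Prop
  | o : PermEq RT.o RT.o
  | arr {as bs : List RT} {a b : RT} (h : ListPermEq as bs) (h' : PermEq a b) :
      PermEq (RT.arr as a) (RT.arr bs b)

/-- Equality of lists of resource types up to permutation, at top level and inside. -/
inductive ListPermEq : List RT → List RT → Prop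
  | nil : ListPermEq [] []
  | cons {a b : RT} {as bs : List RT} (h : PermEq a b) (h' : ListPermEq as bs) :
      ListPermEq (a :: as) (b :: bs)
  | swap (a b : RT) (as : List RT) : ListPermEq (a :: b :: as) (b :: a :: as)
  | trans {as bs cs : List RT} (h : ListPermEq as bs) (h' : ListPermEq bs cs) : ListPermEq as cs

end

mutual

theorem PermEq.refl : ∀ a : RT, PermEq a a
  | .o => .o
  | .arr as a => .arr (ListPermEq.refl as) (PermEq.refl a)

theorem ListPermEq.refl : ∀ as : List RT, ListPermEq as as
  | [] => .nil
  | a :: as => .cons (PermEq.refl a) (ListPermEq.refl as)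

end

mutual

theorem PermEq.symm : ∀ {a b : RT}, PermEq a b → PermEq b a
  | _, _, .o => .o
  | _, _, .arr h h' => .arr h.symm h'.symm

theorem ListPermEq.symm : ∀ {as bs : List RT}, ListPermEq as bs → ListPermEq bs as
  | _, _, .nil => .nil
  | _, _, .cons h h' => .cons h.symm h'.symm
  | _, _, .swap a b as => .swap b a as
  | _, _, .trans h h' => .trans h'.symm h.symm

end

theorem PermEq.trans : ∀ {a b c : RT}, PermEq a b → PermEq b c → PermEq a c
  | _, _, _, .o, h => h
  | _, _, _, .arr h₁ h₂, .arr h₁' h₂' => .arr (h₁.trans h₁') (h₂.trans h₂')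

instance permSetoid : Setoid RT := ⟨PermEq, PermEq.refl, PermEq.symm, PermEq.trans⟩

/-- The type of multitypes. -/
def MT : Type := Quotient permSetoid

/-- The multitype of a resource type, obtained by replacing lists by multisets. -/
def under (a : RT) : MT := Quotient.mk permSetoid a

/-- The multiset of multitypes of an intersection type. -/
def underList (as : List RT) : Multiset MT := (as.map under : List MT)

/-- The multitype context of a context. -/
def underCtx {n : ℕ} (γ : Ctx n) : Fin n → Multiset MT := fun i => underList (γ i)

/-- The multitype `o`. -/
def MT.o : MT := under RT.o

/-- A resource type representing a given multitype. -/
noncomputable def MT.rep (A : MT) : RT := Quotient.out (s := permSetoid) A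

/-- The multitype `m ⊸ A`, for a finite multiset `m` of multitypes (see `under_arr`). -/
noncomputable def MT.arr (m : Multiset MT) (A : MT) : MT :=
  under (RT.arr (m.toList.map MT.rep) A.rep)

theorem under_rep (A : MT) : under A.rep = A := Quotient.out_eq (s := permSetoid) A

theorem under_eq_iff {a b : RT} : under a = under b ↔ PermEq a b :=
  Quotient.eq (r := permSetoid)

theorem underList_eq_iff {as bs : List RT} : underList as = underList bs ↔ ListPermEq as bs := by
  constructor
  · intro h
    have key : ∀ {p q : List MT}, p.Perm q → ListPermEq (p.map MT.rep) (q.map MT.rep) := by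
      intro p q hpq
      induction hpq with
      | nil => exact .nil
      | cons x _ ih => exact .cons (PermEq.refl _) ih
      | swap x y l => exact .swap _ _ _
      | trans _ _ ih₁ ih₂ => exact .trans ih₁ ih₂
    have out : ∀ l : List RT, ListPermEq ((l.map under).map MT.rep) l := by
      intro l
      induction l with
      | nil => exact .nil
      | cons a l ih => exact .cons (under_eq_iff.1 (under_rep (under a))) ih
    exact ((out as).symm.trans (key (Multiset.coe_eq_coe.1 h))).trans (out bs)
  · exact go
where
  go : ∀ {as bs : List RT}, ListPermEq as bs → underList as = underList bs
    | _, _, .nil => rfl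
    | _, _, .cons h h' => congrArg₂ Multiset.cons (under_eq_iff.2 h) (go h')
    | _, _, .swap a b as => Multiset.cons_swap (under a) (under b) (underList as)
    | _, _, .trans h h' => (go h).trans (go h')

/-- Replacing lists by multisets commutes with the arrow. -/
theorem under_arr (as : List RT) (a : RT) :
    under (RT.arr as a) = MT.arr (underList as) (under a) := by
  refine under_eq_iff.2 (PermEq.arr ?_ ?_)
  · refine underList_eq_iff.1 ?_
    have h : under ∘ MT.rep = id := funext under_rep
    rw [underList.eq_def (List.map MT.rep _), List.map_map, h, List.map_id, Multiset.coe_toList]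
  · exact under_eq_iff.1 (under_rep (under a)).symm

/-! ### The Scott preorder -/

mutual

/-- The Scott preorder on multitypes. -/
inductive ScottLE : MT → MT → Prop
  | refl (A : MT) : ScottLE A A
  | trans {A B C : MT} (h : ScottLE A B) (h' : ScottLE B C) : ScottLE A C
  | arr {m m' : Multiset MT} {A A' : MT} (h : MScottLE m' m) (h' : ScottLE A A') :
      ScottLE (MT.arr m A) (MT.arr m' A')

/-- The Scott preorder on multisets of multitypes (intersections): the compatible preorder
generated by `[A] ≤ [A, A]`, `[A₁, A₂] ≤ [Aᵢ]` and `[A₁, …, Aₖ] ≤ []`. -/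
inductive MScottLE : Multiset MT → Multiset MT → Prop
  | refl (m : Multiset MT) : MScottLE m m
  | trans {m₁ m₂ m₃ : Multiset MT} (h : MScottLE m₁ m₂) (h' : MScottLE m₂ m₃) : MScottLE m₁ m₃
  | dup (A : MT) : MScottLE {A} {A, A}
  | projLeft (A B : MT) : MScottLE {A, B} {A}
  | projRight (A B : MT) : MScottLE {A, B} {B}
  | weak (m : Multiset MT) : MScottLE m 0
  | single {A B : MT} (h : ScottLE A B) : MScottLE {A} {B}
  | add {m m' p p' : Multiset MT} (h : MScottLE m m') (h' : MScottLE p p') :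
      MScottLE (m + p) (m' + p')

end

/-! ### Interpretations -/

/-- The interpretation of a λ-term by the typings of its approximations in the calculus of the
given mode, with lists replaced by multisets. -/
def interp (k : Mode) {n : ℕ} (M : Lam n) : Set ((Fin n → Multiset MT) × MT) :=
  {p | ∃ (γ : Ctx n) (a : RT) (s : RTerm k n),
    Approx s M ∧ SubTyped γ s a ∧ p = (underCtx γ, under a)}

/-- The relational (non-idempotent) interpretation. -/
def relInterp {n : ℕ} (M : Lam n) : Set ((Fin n → Multiset MT) × MT) := interp Mode.lin M

/-- The Scott (idempotent) interpretation. -/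
def scottInterp {n : ℕ} (M : Lam n) : Set ((Fin n → Multiset MT) × MT) := interp Mode.cart M

/-- The downward closure `↓S`: all `(Γ, A)` with `Γ ≤ Γ'` and `B ≤ A` for some `(Γ', B) ∈ S`. -/
def downClosure {n : ℕ} (S : Set ((Fin n → Multiset MT) × MT)) :
    Set ((Fin n → Multiset MT) × MT) :=
  {p | ∃ q ∈ S, (∀ i, MScottLE (p.1 i) (q.1 i)) ∧ ScottLE q.2 p.2}

end Resource

namespace Resource

/-! ### Existence of morphisms -/

theorem Hom.nonempty_refl (k : Mode) : ∀ a : RT, Nonempty (Hom k a a)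
  | .o => ⟨.idO⟩
  | .arr as a => by
    have h : ∀ i : Fin as.length, Nonempty (Hom k (as.get i) (as.get i)) := fun i =>
      have : sizeOf as[i.1] < sizeOf as := List.sizeOf_lt_of_mem (List.get_mem as i)
      Hom.nonempty_refl k (as.get i)
    obtain ⟨g⟩ := Hom.nonempty_refl k a
    refine ⟨.arr (.mk id ?_ fun i => (h i).some) g⟩
    cases k
    · exact Function.bijective_id
    · trivial
termination_by a => sizeOf a

theorem IHom.nonempty_refl (k : Mode) (as : List RT) : Nonempty (IHom k as as) := by
  obtain ⟨f⟩ := Hom.nonempty_refl k (.arr as .o)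
  cases f with
  | arr f _ => exact ⟨f⟩

/-- There is a cartesian morphism `a → b`. -/
def HomLE (a b : RT) : Prop := Nonempty (Hom .cart a b)

/-- Every element of `bs` is the target of a cartesian morphism from an element of `as`. -/
def ListHomLE (as bs : List RT) : Prop := ∀ b ∈ bs, ∃ a ∈ as, HomLE a b

theorem nonempty_iHom_cart_iff {as bs : List RT} :
    Nonempty (IHom .cart as bs) ↔ ListHomLE as bs := by
  constructor
  · rintro ⟨α, -, f⟩ b hb
    obtain ⟨i, rfl⟩ := List.get_of_mem hb
    exact ⟨_, List.get_mem as (α i), ⟨f i⟩⟩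
  · intro h
    have h' : ∀ i : Fin bs.length, ∃ j : Fin as.length, HomLE (as.get j) (bs.get i) := by
      intro i
      obtain ⟨a, ha, hab⟩ := h _ (List.get_mem bs i)
      obtain ⟨j, rfl⟩ := List.get_of_mem ha
      exact ⟨j, hab⟩
    choose α hα using h'
    exact ⟨.mk α trivial fun i => (hα i).some⟩

theorem HomLE.refl (a : RT) : HomLE a a := Hom.nonempty_refl _ a

theorem HomLE.arr {as bs : List RT} {a b : RT} (h : ListHomLE bs as) (h' : HomLE a b) :
    HomLE (.arr as a) (.arr bs b) := by
  obtain ⟨f⟩ := nonempty_iHom_cart_iff.2 h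
  obtain ⟨g⟩ := h'
  exact ⟨.arr f g⟩

theorem HomLE.arr_left {as : List RT} {a c : RT} (h : HomLE (.arr as a) c) :
    ∃ bs b, c = .arr bs b ∧ ListHomLE bs as ∧ HomLE a b := by
  obtain ⟨f⟩ := h
  cases f with
  | arr f g => exact ⟨_, _, rfl, nonempty_iHom_cart_iff.1 ⟨f⟩, ⟨g⟩⟩

theorem HomLE.arr_right {bs : List RT} {b c : RT} (h : HomLE c (.arr bs b)) :
    ∃ as a, c = .arr as a ∧ ListHomLE bs as ∧ HomLE a b := by
  obtain ⟨f⟩ := h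
  cases f with
  | arr f g => exact ⟨_, _, rfl, nonempty_iHom_cart_iff.1 ⟨f⟩, ⟨g⟩⟩

theorem HomLE.o_left {c : RT} (h : HomLE .o c) : c = .o := by
  obtain ⟨f⟩ := h
  cases f
  rfl

theorem HomLE.o_right {c : RT} (h : HomLE c .o) : c = .o := by
  obtain ⟨f⟩ := h
  cases f
  rfl

theorem HomLE.trans : ∀ {a b c : RT}, HomLE a b → HomLE b c → HomLE a c
  | _, .o, _, h, h' => by rwa [h.o_right]
  | _, .arr bs b, _, h, h' => by
    obtain ⟨as, a, rfl, hl, hr⟩ := h.arr_right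
    obtain ⟨cs, c, rfl, hl', hr'⟩ := h'.arr_left
    refine HomLE.arr (fun x hx => ?_) (HomLE.trans hr hr')
    obtain ⟨y, hy, hyx⟩ := hl x hx
    obtain ⟨z, hz, hzy⟩ := hl' y hy
    have := List.sizeOf_lt_of_mem hy
    exact ⟨z, hz, HomLE.trans hzy hyx⟩
termination_by _ b => sizeOf b

theorem ListHomLE.refl (as : List RT) : ListHomLE as as := fun a ha => ⟨a, ha, HomLE.refl a⟩

theorem ListHomLE.trans {as bs cs : List RT} (h : ListHomLE as bs) (h' : ListHomLE bs cs) :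
    ListHomLE as cs := fun c hc => by
  obtain ⟨b, hb, hbc⟩ := h' c hc
  obtain ⟨a, ha, hab⟩ := h b hb
  exact ⟨a, ha, hab.trans hbc⟩

theorem ListHomLE.append {as as' bs bs' : List RT} (h : ListHomLE as bs)
    (h' : ListHomLE as' bs') : ListHomLE (as ++ as') (bs ++ bs') := fun b hb => by
  rcases List.mem_append.1 hb with hb | hb
  · obtain ⟨a, ha, hab⟩ := h b hb
    exact ⟨a, List.mem_append_left _ ha, hab⟩
  · obtain ⟨a, ha, hab⟩ := h' b hb
    exact ⟨a, List.mem_append_right _ ha, hab⟩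

/-! ### Cartesian morphisms and the Scott preorder -/

mutual

theorem PermEq.homLE : ∀ {a b : RT}, PermEq a b → HomLE a b ∧ HomLE b a
  | _, _, .o => ⟨HomLE.refl _, HomLE.refl _⟩
  | _, _, .arr h h' =>
    ⟨HomLE.arr h.listHomLE.2 h'.homLE.1, HomLE.arr h.listHomLE.1 h'.homLE.2⟩

theorem ListPermEq.listHomLE :
    ∀ {as bs : List RT}, ListPermEq as bs → ListHomLE as bs ∧ ListHomLE bs as
  | _, _, .nil => ⟨ListHomLE.refl _, ListHomLE.refl _⟩
  | _, _, .cons (a := a) (b := b) h h' => by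
    have h₁ : ListHomLE [a] [b] := by simpa [ListHomLE] using h.homLE.1
    have h₂ : ListHomLE [b] [a] := by simpa [ListHomLE] using h.homLE.2
    exact ⟨h₁.append h'.listHomLE.1, h₂.append h'.listHomLE.2⟩
  | _, _, .swap a b as =>
    ⟨fun x hx => ⟨x, (List.Perm.swap a b as).mem_iff.1 hx, HomLE.refl x⟩,
      fun x hx => ⟨x, (List.Perm.swap b a as).mem_iff.1 hx, HomLE.refl x⟩⟩
  | _, _, .trans h h' =>
    ⟨h.listHomLE.1.trans h'.listHomLE.1, h'.listHomLE.2.trans h.listHomLE.2⟩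

end

theorem MScottLE.add_self (m : Multiset MT) : MScottLE m (m + m) := by
  induction m using Multiset.induction with
  | empty => exact .refl _
  | cons A m ih =>
    have h := MScottLE.add (.dup A) ih
    rw [← Multiset.singleton_add]
    convert h using 1
    rw [show ({A, A} : Multiset MT) = {A} + {A} from rfl]
    abel

theorem MScottLE.singleton_of_mem {m : Multiset MT} {A : MT} (h : A ∈ m) : MScottLE m {A} := by
  obtain ⟨p, rfl⟩ := Multiset.exists_cons_of_mem h
  rw [← Multiset.singleton_add]
  simpa using MScottLE.add (.refl {A}) (.weak p)

theorem MScottLE.of_forall_mem {m p : Multiset MT} (h : ∀ B ∈ p, ∃ A ∈ m, ScottLE A B) :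
    MScottLE m p := by
  induction p using Multiset.induction with
  | empty => exact .weak m
  | cons B p ih =>
    obtain ⟨A, hA, hAB⟩ := h B (Multiset.mem_cons_self B p)
    rw [← Multiset.singleton_add]
    exact (add_self m).trans (.add ((singleton_of_mem hA).trans (.single hAB))
      (ih fun C hC => h C (Multiset.mem_cons_of_mem hC)))

theorem mem_underList {A : MT} {as : List RT} : A ∈ underList as ↔ ∃ a ∈ as, under a = A := by
  simp [underList]

theorem underCtx_surjective {n : ℕ} : Function.Surjective (underCtx (n := n)) := fun Γ =>
  have h : under ∘ MT.rep = id := funext under_rep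
  ⟨fun i => (Γ i).toList.map MT.rep, funext fun i => by simp [underCtx, underList, h]⟩

theorem HomLE.scottLE : ∀ {a b : RT}, HomLE a b → ScottLE (under a) (under b)
  | .o, _, h => by
    rw [h.o_left]
    exact .refl _
  | .arr as a, .o, h => by
    obtain ⟨_, _, ⟨⟩, _⟩ := h.arr_left
  | .arr as a, .arr bs b, h => by
    obtain ⟨_, _, ⟨⟩, hl, hr⟩ := h.arr_left
    rw [under_arr, under_arr]
    refine .arr (.of_forall_mem fun A hA => ?_) hr.scottLE
    obtain ⟨x, hx, rfl⟩ := mem_underList.1 hA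
    obtain ⟨y, hy, hyx⟩ := hl x hx
    have := List.sizeOf_lt_of_mem hx
    have := List.sizeOf_lt_of_mem hy
    exact ⟨_, mem_underList.2 ⟨y, hy, rfl⟩, hyx.scottLE⟩
termination_by a b => sizeOf a + sizeOf b

theorem ListHomLE.mScottLE {as bs : List RT} (h : ListHomLE as bs) :
    MScottLE (underList as) (underList bs) := by
  refine .of_forall_mem fun B hB => ?_
  obtain ⟨b, hb, rfl⟩ := mem_underList.1 hB
  obtain ⟨a, ha, hab⟩ := h b hb
  exact ⟨_, mem_underList.2 ⟨a, ha, rfl⟩, hab.scottLE⟩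

theorem homLE_of_under_eq {a b : RT} (h : under a = under b) : HomLE a b :=
  (under_eq_iff.1 h).homLE.1

mutual

theorem ScottLE.homLE_rep : ∀ {A B : MT}, ScottLE A B → HomLE A.rep B.rep
  | _, _, .refl A => HomLE.refl _
  | _, _, .trans h h' => h.homLE_rep.trans h'.homLE_rep
  | _, _, .arr h h' => by
    refine (homLE_of_under_eq (under_rep _)).trans
      (.trans ?_ (homLE_of_under_eq (under_rep _).symm))
    refine .arr (fun x hx => ?_) h'.homLE_rep
    obtain ⟨B, hB, rfl⟩ := List.mem_map.1 hx
    obtain ⟨A, hA, hAB⟩ := h.exists_homLE_rep B (Multiset.mem_toList.1 hB)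
    exact ⟨_, List.mem_map.2 ⟨A, Multiset.mem_toList.2 hA, rfl⟩, hAB⟩

theorem MScottLE.exists_homLE_rep :
    ∀ {m p : Multiset MT}, MScottLE m p → ∀ B ∈ p, ∃ A ∈ m, HomLE A.rep B.rep
  | _, _, .refl m => fun B hB => ⟨B, hB, HomLE.refl _⟩
  | _, _, .trans h h' => fun C hC => by
    obtain ⟨B, hB, hBC⟩ := h'.exists_homLE_rep C hC
    obtain ⟨A, hA, hAB⟩ := h.exists_homLE_rep B hB
    exact ⟨A, hA, hAB.trans hBC⟩
  | _, _, .dup A => fun B hB => ⟨B, by simpa using hB, HomLE.refl _⟩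
  | _, _, .projLeft A A' => fun B hB => ⟨B, by simp at hB ⊢; tauto, HomLE.refl _⟩
  | _, _, .projRight A A' => fun B hB => ⟨B, by simp at hB ⊢; tauto, HomLE.refl _⟩
  | _, _, .weak m => fun B hB => absurd hB (Multiset.notMem_zero B)
  | _, _, .single (A := A) h => fun C hC => by
    rw [Multiset.mem_singleton.1 hC]
    exact ⟨A, Multiset.mem_singleton_self A, h.homLE_rep⟩
  | _, _, .add h h' => fun B hB => by
    rcases Multiset.mem_add.1 hB with hB | hB
    · obtain ⟨A, hA, hAB⟩ := h.exists_homLE_rep B hB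
      exact ⟨A, Multiset.mem_add.2 (.inl hA), hAB⟩
    · obtain ⟨A, hA, hAB⟩ := h'.exists_homLE_rep B hB
      exact ⟨A, Multiset.mem_add.2 (.inr hA), hAB⟩

end

theorem ScottLE.homLE {a b : RT} (h : ScottLE (under a) (under b)) : HomLE a b :=
  (homLE_of_under_eq (under_rep _).symm).trans
    (h.homLE_rep.trans (homLE_of_under_eq (under_rep _)))

theorem MScottLE.listHomLE {as bs : List RT} (h : MScottLE (underList as) (underList bs)) :
    ListHomLE as bs := fun b hb => by
  obtain ⟨A, hA, hAb⟩ := h.exists_homLE_rep _ (mem_underList.2 ⟨b, hb, rfl⟩)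
  obtain ⟨a, ha, rfl⟩ := mem_underList.1 hA
  exact ⟨a, ha, (homLE_of_under_eq (under_rep _).symm).trans
    (hAb.trans (homLE_of_under_eq (under_rep _)))⟩

/-! ### From linear to cartesian typings -/

mutual

theorem Hom.homLE {k : Mode} : ∀ {a b : RT}, Hom k a b → HomLE a b
  | _, _, .idO => HomLE.refl _
  | _, _, .arr f g => HomLE.arr f.listHomLE g.homLE

theorem IHom.listHomLE {k : Mode} : ∀ {as bs : List RT}, IHom k as bs → ListHomLE as bs
  | _, _, .mk α _ f => nonempty_iHom_cart_iff.1 ⟨.mk α trivial fun i => (f i).homLE.some⟩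

end

theorem listHomLE_single {n : ℕ} (i : Fin n) {a b : RT} (h : HomLE a b) (j : Fin n) :
    ListHomLE (Ctx.single i a j) (Ctx.single i b j) := by
  by_cases hj : j = i
  · subst hj
    simpa [Ctx.single, ListHomLE] using h
  · simp [Ctx.single, Ctx.empty, hj, ListHomLE]

mutual

/-- Every typing yields a cartesian typing of an approximation of the same λ-term, at any larger
type. -/
theorem Typed.exists_cart {k : Mode} : ∀ {n : ℕ} {γ : Ctx n} {s : RTerm k n} {a : RT},
    Typed γ s a → ∀ {M : Lam n}, Approx s M → ∀ {b : RT}, HomLE a b →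
      ∃ (δ : Ctx n) (t : RTerm .cart n), (∀ i, ListHomLE (γ i) (δ i)) ∧ Approx t M ∧ Typed δ t b
  | _, _, _, _, .var i a, _, .var _, b, hab =>
    ⟨Ctx.single i b, .var i, listHomLE_single i hab, .var i, .var i b⟩
  | _, γ, _, _, .lam (as := as) (bs := bs) f hs, _, .lam _ hM, c, hc => by
    obtain ⟨cs, c, rfl, hl, hr⟩ := hc.arr_left
    obtain ⟨δ, t, hδ, ht, ht'⟩ := hs.exists_cart hM hr
    have hf : ListHomLE as bs := f.listHomLE
    have hd : δ = Ctx.extend (fun i => δ i.succ) (δ 0) := (Fin.cons_self_tail δ).symm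
    obtain ⟨g⟩ := nonempty_iHom_cart_iff.2 ((hl.trans hf).trans (hδ 0))
    exact ⟨fun i => δ i.succ, .lam g t, fun i => hδ i.succ, .lam g ht, .lam g (hd ▸ ht')⟩
  | _, _, _, _, .app hs ht, _, .app hM hN, c, hc => by
    obtain ⟨δ, s', hδ, hs', hs''⟩ := hs.exists_cart hM (HomLE.arr (ListHomLE.refl _) hc)
    obtain ⟨δ', t', hδ', ht', ht''⟩ := ht.exists_cart hN
    exact ⟨δ.tensor δ', .app s' t', fun i => (hδ i).append (hδ' i), .app hs' ht', .app hs'' ht''⟩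

theorem BagTyped.exists_cart {k : Mode} : ∀ {n : ℕ} {γ : Ctx n} {t : Bag k n} {as : List RT},
    BagTyped γ t as → ∀ {M : Lam n}, BagApprox t M →
      ∃ (δ : Ctx n) (t' : Bag .cart n),
        (∀ i, ListHomLE (γ i) (δ i)) ∧ BagApprox t' M ∧ BagTyped δ t' as
  | _, _, _, _, .nil, _, _ => ⟨_, .nil, fun _ => ListHomLE.refl _, .nil, .nil⟩
  | _, _, _, _, .cons hs ht, _, .cons hM hN => by
    obtain ⟨δ, s', hδ, hs', hs''⟩ := hs.exists_cart hM (HomLE.refl _)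
    obtain ⟨δ', t', hδ', ht', ht''⟩ := ht.exists_cart hN
    exact ⟨δ.tensor δ', .cons s' t', fun i => (hδ i).append (hδ' i), .cons hs' ht',
      .cons hs'' ht''⟩

end

/-! ### Realizability of types by sets of types -/

/-- Application of sets of resource types: all `b` with `⟨a₁, …, aₖ⟩ ⊸ b ∈ X` and
`a₁, …, aₖ ∈ Y`. -/
def setApp (X Y : Set RT) : Set RT := {b | ∃ as : List RT, (∀ a ∈ as, a ∈ Y) ∧ RT.arr as b ∈ X}

theorem setApp_mono {X X' Y : Set RT} (h : X ⊆ X') : setApp X Y ⊆ setApp X' Y :=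
  fun _ ⟨as, has, hb⟩ => ⟨as, has, h hb⟩

/-- The set of resource types `X` realizes a given type. -/
def Realizes : RT → Set RT → Prop
  | .o, X => RT.o ∈ X
  | .arr as b, X => ∀ Y : Set RT, (∀ a ∈ as, Realizes a Y) → Realizes b (setApp X Y)

theorem Realizes.mono : ∀ {a : RT} {X X' : Set RT}, X ⊆ X' → Realizes a X → Realizes a X'
  | .o, _, _, h, hX => by
    rw [Realizes] at hX ⊢
    exact h hX
  | .arr as b, _, _, h, hX => by
    rw [Realizes] at hX ⊢
    exact fun Y hY => (hX Y hY).mono (setApp_mono h)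

theorem Realizes.of_homLE : ∀ {a b : RT} {X : Set RT}, HomLE a b → Realizes a X → Realizes b X
  | .o, _, _, h, hX => by rwa [h.o_left]
  | .arr as a, .o, _, h, _ => by
    obtain ⟨_, _, ⟨⟩, _⟩ := h.arr_left
  | .arr as a, .arr bs b, X, h, hX => by
    obtain ⟨_, _, ⟨⟩, hl, hr⟩ := h.arr_left
    rw [Realizes] at hX ⊢
    refine fun Y hY => Realizes.of_homLE hr (hX Y fun x hx => ?_)
    obtain ⟨y, hy, hyx⟩ := hl x hx
    have := List.sizeOf_lt_of_mem hx
    have := List.sizeOf_lt_of_mem hy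
    exact Realizes.of_homLE hyx (hY y hy)
termination_by a b => sizeOf a + sizeOf b

/-- A realizer of `a` contains a type below `a`, and the set of types above `a` realizes `a`. -/
theorem realizes_reify_reflect : ∀ a : RT,
    (∀ X, Realizes a X → ∃ b ∈ X, HomLE b a) ∧ Realizes a {b | HomLE a b}
  | .o => by
    refine ⟨fun X hX => ?_, ?_⟩
    · rw [Realizes] at hX
      exact ⟨_, hX, HomLE.refl _⟩
    · rw [Realizes]
      exact HomLE.refl _
  | .arr as b => by
    have ih : ∀ a ∈ as,
        (∀ X, Realizes a X → ∃ b ∈ X, HomLE b a) ∧ Realizes a {b | HomLE a b} := fun a ha =>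
      have := List.sizeOf_lt_of_mem ha
      realizes_reify_reflect a
    obtain ⟨ihb, ihb'⟩ := realizes_reify_reflect b
    refine ⟨fun X hX => ?_, ?_⟩
    · rw [Realizes] at hX
      obtain ⟨c, ⟨cs, hcs, hc⟩, hcb⟩ := ihb _ (hX {c | ∃ a ∈ as, HomLE a c} fun a ha =>
        (ih a ha).2.mono fun c hc => ⟨a, ha, hc⟩)
      exact ⟨_, hc, HomLE.arr hcs hcb⟩
    · rw [Realizes]
      intro Y hY
      have h : ∀ a : {a // a ∈ as}, ∃ c ∈ Y, HomLE c a := fun a => (ih a a.2).1 Y (hY a a.2)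
      choose f hf hf' using h
      refine ihb'.mono fun c hc => ⟨as.attach.map f, ?_, HomLE.arr ?_ hc⟩
      · intro x hx
        obtain ⟨a, -, rfl⟩ := List.mem_map.1 hx
        exact hf a
      · exact fun a ha => ⟨f ⟨a, ha⟩, List.mem_map_of_mem (List.mem_attach as ⟨a, ha⟩), hf' ⟨a, ha⟩⟩

/-! ### The linear interpretation as a set of types -/

/-- The types obtained by linear typings of the approximations of `M`, in contexts with entries
in the given sets. -/
def linSem {n : ℕ} (M : Lam n) (Y : Fin n → Set RT) : Set RT :=
  {a | ∃ (γ : Ctx n) (s : RTerm .lin n), Approx s M ∧ Typed γ s a ∧ ∀ i, ∀ c ∈ γ i, c ∈ Y i}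

theorem subset_linSem_var {n : ℕ} (i : Fin n) (Y : Fin n → Set RT) :
    Y i ⊆ linSem (.var i) Y := fun a ha => by
  refine ⟨_, _, .var i, .var i a, fun j c hc => ?_⟩
  by_cases hj : j = i
  · subst hj
    simp only [Ctx.single, Function.update_self, List.mem_singleton] at hc
    rwa [hc]
  · simp [Ctx.single, Ctx.empty, hj] at hc

theorem linSem_subset_setApp_lam {n : ℕ} (M : Lam (n + 1)) (Y : Fin n → Set RT) (Z : Set RT) :
    linSem M (Fin.cons (α := fun _ => Set RT) Z Y) ⊆ setApp (linSem (.lam M) Y) Z := by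
  rintro a ⟨γ, s, hs, ht, hγ⟩
  obtain ⟨f⟩ := IHom.nonempty_refl .lin (γ 0)
  have hd : γ = Ctx.extend (fun i => γ i.succ) (γ 0) := (Fin.cons_self_tail γ).symm
  exact ⟨γ 0, hγ 0, fun i => γ i.succ, .lam f s, .lam f hs, .lam f (hd ▸ ht), fun i => hγ i.succ⟩

theorem exists_bagTyped_of_forall_mem_linSem {n : ℕ} {N : Lam n} {Y : Fin n → Set RT} :
    ∀ {as : List RT}, (∀ a ∈ as, a ∈ linSem N Y) → ∃ (γ : Ctx n) (t : Bag .lin n),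
      BagApprox t N ∧ BagTyped γ t as ∧ ∀ i, ∀ c ∈ γ i, c ∈ Y i
  | [], _ => ⟨_, _, .nil, .nil, fun i c hc => absurd hc List.not_mem_nil⟩
  | a :: as, h => by
    obtain ⟨γ, s, hs, hs', hγ⟩ := h a List.mem_cons_self
    obtain ⟨δ, t, ht, ht', hδ⟩ :=
      exists_bagTyped_of_forall_mem_linSem fun x hx => h x (List.mem_cons_of_mem a hx)
    exact ⟨_, _, .cons hs ht, .cons hs' ht', fun i c hc =>
      (List.mem_append.1 hc).elim (hγ i c) (hδ i c)⟩

theorem setApp_linSem_subset {n : ℕ} (M N : Lam n) (Y : Fin n → Set RT) :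
    setApp (linSem M Y) (linSem N Y) ⊆ linSem (.app M N) Y := by
  rintro b ⟨as, has, γ, s, hs, hs', hγ⟩
  obtain ⟨δ, t, ht, ht', hδ⟩ := exists_bagTyped_of_forall_mem_linSem has
  exact ⟨_, _, .app hs ht, .app hs' ht', fun i c hc =>
    (List.mem_append.1 hc).elim (hγ i c) (hδ i c)⟩

mutual

/-- Adequacy: the linear interpretation of `M` realizes the types of its cartesian
approximations. -/
theorem Typed.realizes_linSem : ∀ {n : ℕ} {γ : Ctx n} {s : RTerm .cart n} {a : RT},
    Typed γ s a → ∀ {M : Lam n}, Approx s M → ∀ {Y : Fin n → Set RT},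
      (∀ i, ∀ c ∈ γ i, Realizes c (Y i)) → Realizes a (linSem M Y)
  | _, _, _, _, .var i a, _, .var _, Y, hY =>
    (hY i a (by simp [Ctx.single])).mono (subset_linSem_var i Y)
  | _, γ, _, _, .lam f hs, _, .lam (M := M) _ hM, Y, hY => by
    rw [Realizes]
    refine fun Z hZ => (hs.realizes_linSem hM ?_).mono (linSem_subset_setApp_lam M Y Z)
    refine Fin.cases (fun b hb => ?_) hY
    obtain ⟨a, ha, hab⟩ := nonempty_iHom_cart_iff.1 ⟨f⟩ b hb
    exact (hZ a ha).of_homLE hab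
  | _, _, _, _, .app hs ht, _, .app (M := M) (N := N) hM hN, Y, hY => by
    have h := hs.realizes_linSem hM fun i c hc => hY i c (List.mem_append_left _ hc)
    rw [Realizes] at h
    exact (h _ (ht.realizes_linSem hN fun i c hc => hY i c (List.mem_append_right _ hc))).mono
      (setApp_linSem_subset M N Y)

theorem BagTyped.realizes_linSem : ∀ {n : ℕ} {γ : Ctx n} {t : Bag .cart n} {as : List RT},
    BagTyped γ t as → ∀ {M : Lam n}, BagApprox t M → ∀ {Y : Fin n → Set RT},
      (∀ i, ∀ c ∈ γ i, Realizes c (Y i)) → ∀ a ∈ as, Realizes a (linSem M Y)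
  | _, _, _, _, .nil, _, _, _, _ => fun _ ha => absurd ha List.not_mem_nil
  | _, _, _, _, .cons hs ht, _, .cons hM hN, _, hY =>
    List.forall_mem_cons.2
      ⟨hs.realizes_linSem hM fun i c hc => hY i c (List.mem_append_left _ hc),
        ht.realizes_linSem hN fun i c hc => hY i c (List.mem_append_right _ hc)⟩

end

/-- A cartesian typing of an approximation of `M` lies above a linear one. -/
theorem Typed.exists_lin {n : ℕ} {γ : Ctx n} {s : RTerm .cart n} {a : RT} {M : Lam n}
    (hs : Typed γ s a) (hM : Approx s M) :
    ∃ (δ : Ctx n) (t : RTerm .lin n) (b : RT),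
      Approx t M ∧ Typed δ t b ∧ (∀ i, ListHomLE (γ i) (δ i)) ∧ HomLE b a := by
  have h := hs.realizes_linSem hM (Y := fun i => {c | ∃ a ∈ γ i, HomLE a c}) fun i c hc =>
    (realizes_reify_reflect c).2.mono fun d hd => ⟨c, hc, hd⟩
  obtain ⟨b, ⟨δ, t, ht, ht', hδ⟩, hba⟩ := (realizes_reify_reflect a).1 _ h
  exact ⟨δ, t, b, ht, ht', hδ, hba⟩

theorem scottInterp_eq_downClosure {n : ℕ} (M : Lam n) :
    scottInterp M = downClosure (relInterp M) := by
  ext p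
  constructor
  · rintro ⟨γ, a, s, hs, ⟨γ', hγ, ht⟩, rfl⟩
    obtain ⟨δ, t, b, ht, ht', hδ, hb⟩ := ht.exists_lin hs
    exact ⟨_, ⟨δ, b, t, ht, ⟨δ, fun i => IHom.nonempty_refl _ _, ht'⟩, rfl⟩,
      fun i => ((nonempty_iHom_cart_iff.1 (hγ i)).trans (hδ i)).mScottLE, hb.scottLE⟩
  · obtain ⟨Γ, A⟩ := p
    rintro ⟨_, ⟨γ, a, s, hs, ⟨γ', hγ, ht⟩, rfl⟩, hΓ, hA⟩
    obtain ⟨γ₀, rfl⟩ := underCtx_surjective Γ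
    obtain ⟨b, rfl⟩ : ∃ b, under b = A := ⟨A.rep, under_rep A⟩
    obtain ⟨δ, t, hδ, ht, ht'⟩ := ht.exists_cart hs hA.homLE
    exact ⟨γ₀, b, t, ht, ⟨δ, fun i => nonempty_iHom_cart_iff.2
      (((hΓ i).listHomLE.trans (hγ i).some.listHomLE).trans (hδ i)), ht'⟩, rfl⟩

end Resource

theorem mainTheorem6 (n : ℕ) (M : Resource.Lam n) :
    Resource.scottInterp M = Resource.downClosure (Resource.relInterp M) :=
  Resource.scottInterp_eq_downClosure M
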